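/- Let $d$ be a prime power, let $\{|\phi^a_x\rangle\}_{a=0}^{d-1}$, $x=0,\dots,d$, be a complete set of $d+1$ mutually unbiased orthonormal bases of $\mathbb{C}^d$ (so $|\langle\phi^a_x|\phi^b_y\rangle|=\delta_{ab}$ for $x=y$ and $=1/\sqrt d$ for $x\ne y$), let $0\le\eta\le1$, and let $$\rho_{a|x}(\eta)=\frac{\eta}{d}|\phi^a_x\rangle\langle\phi^a_x|+(1-\eta)\frac{I}{d^2}.$$ **Definitions.** An *assemblage* is a family of positive semidefinite operators $\rho_{a|x}$ on $\mathbb{C}^d$ such that $\sum_a\rho_{a|x}$ is a density operator independent of $x$. It is *unsteerable* if $\rho_{a|x}=\int p(a|x,\lambda)\,\omega_\lambda\,d\mu(\lambda)$ for a probability measure $\mu$, conditional probabilities $p(a|x,\lambda)$ and density operators $\omega_\lambda$. The *steering robustness* $\mathcal R(\{\rho_{a|x}\})$ is the infimum (a minimum in the paper) of the $s\ge0$ such that $\{(\rho_{a|x}+s\tau_{a|x})/(1+s)\}$ is unsteerable for some assemblage $\{\tau_{a|x}\}$. A family $\{F_{a|x}\}$ is *dual-feasible* if all $F_{a|x}\ge0$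 and $\sum_{x}F_{\lambda(x)|x}\le I$ for every map $\lambda$ from settings to outcomes. For an inverse temperature $\beta>0$, Hermitian operators $H_{a|x}$ and $n$ settings put $$Q_c(\{\rho_{a|x}\},\{H_{a|x}\})=\frac1n\sum_{a,x}\Big[\operatorname{Tr}(H_{a|x}\rho_{a|x})-\operatorname{Tr}(\rho_{a|x})\frac{\operatorname{Tr}(H_{a|x}e^{-\beta H_{a|x}})}{\operatorname{Tr}(e^{-\beta H_{a|x}})}\Big],$$ and let $$\xi_{\max}(\{\rho_{a|x}\})=\sup_{\{H_{a|x}\}}\frac{Q_c(\{\rho_{a|x}\},\{H_{a|x}\})}{\sup_{\sigma}Q_c(\{\sigma_{a|x}\},\{H_{a|x}\})},$$ where $\sigma$ runs over the unsteerable assemblages with $\operatorname{Tr}\sigma_{a|x}=\operatorname{Tr}\rho_{a|x}$ for all $a,x$, and the outer supremum is over the families of Hermitian operators for which the denominator is positive. **Statement.** For every such $d$, every such bases, every $\beta>0$ and $\eta\in[0,1]$: 1. $\{\rho_{a|x}(\eta)\}$ is an assemblage, the operators $F_{a|x}=|\phi^a_x\rangle\langle\phi^a_x|/(1+\sqrt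 d)$ are dual-feasible, $\sum_{a,x}\operatorname{Tr}[F_{a|x}\rho_{a|x}(\eta)]=1+B(d,\eta)$, and $$\mathcal R(\{\rho_{a|x}(\eta)\})\ \ge\ B(d,\eta):=\sqrt d\,\frac{\sqrt d-1}{\sqrt d+1}\,\eta-\frac{d\sqrt d-1}{d(\sqrt d+1)}\,(1-\eta).$$ 2. $\xi_{\max}(\{\rho_{a|x}(\eta)\})$ is finite and $$\xi_{\max}(\{\rho_{a|x}(\eta)\})\ \ge\ \frac{(d+1)(1+\eta(d-1))}{d(1+\sqrt d)}=1+B(d,\eta).$$ 3. For $\eta=1$, i.e. for $\rho_{a|x}=|\phi^a_x\rangle\langle\phi^a_x|/d$, one has $\mathcal R\ge\sqrt d\,(\sqrt d-1)/(\sqrt d+1)$ and $\xi_{\max}\ge(d+1)/(\sqrt d+1)$, and this bound is of exact order $\sqrt d$: $(d+1)/(\sqrt d+1)=\Theta(\sqrt d)$ as $d\to\infty$ (in particular $O(\sqrt d)$). 4. $B(d,\eta)>0$ if and only if $\eta>\eta_*(d):=1/\big(\sqrt d+\frac{1}{d+\sqrt d+1}\big)$; if $\eta>\eta_*(d)$,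 then $\mathcal R(\{\rho_{a|x}(\eta)\})>0$ and $\xi_{\max}(\{\rho_{a|x}(\eta)\})>1$. 5. The lower bounds grow with the dimension in this regime: for real $D>1$, if $\eta>\eta_*(D)$ then $\partial_D B(D,\eta)>0$, and for fixed $\eta>\eta_*(D_1)$ and every $D_2>D_1>1$ one has $B(D_1,\eta)<B(D_2,\eta)$, hence also $1+B(D_1,\eta)<1+B(D_2,\eta)$ for the lower bound on $\xi_{\max}$. -/

import Mathlib

open Filter Asymptotics
open scoped ComplexOrder

noncomputable section

namespace Cooling

/-- Families of operators on `ℂ^d` indexed by a setting `x` (`n` of them) and an outcome `a`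
(`o` of them); `F x a` is written `F_{a|x}` on paper. -/
abbrev OpFamily (n o d : ℕ) : Type := Fin n → Fin o → Matrix (Fin d) (Fin d) ℂ

/-- An assemblage: positive semidefinite operators `ρ_{a|x}` whose sum over the outcomes is one
and the same density operator (Bob's reduced state) for all settings. -/
def IsAssemblage {n o d : ℕ} (ρ : OpFamily n o d) : Prop :=
  (∀ x a, (ρ x a).PosSemidef) ∧
    ∃ ρB : Matrix (Fin d) (Fin d) ℂ, ρB.trace = 1 ∧ ∀ x, ∑ a, ρ x a = ρB

/-- Unsteerable assemblages: those with a local-hidden-state decomposition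
`σ_{a|x} = ∫ p(a|x,l) ω_l dμ(l)`, where `μ` is a probability measure on the hidden variables,
`r x a l = p(a|x,l)` are conditional probabilities and the `ω l` are density operators. The
integral is taken entry by entry (the integrands are bounded and measurable). -/
def IsUnsteerable {n o d : ℕ} (σ : OpFamily n o d) : Prop :=
  ∃ (Λ : Type) (_ : MeasurableSpace Λ) (μ : MeasureTheory.Measure Λ)
    (r : Fin n → Fin o → Λ → ℝ) (ω : Λ → Matrix (Fin d) (Fin d) ℂ),
    MeasureTheory.IsProbabilityMeasure μ ∧
    (∀ x a, Measurable (r x a)) ∧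
    (∀ x a l, 0 ≤ r x a l) ∧
    (∀ x l, ∑ a, r x a l = 1) ∧
    (∀ i j, Measurable fun l => ω l i j) ∧
    (∀ l, (ω l).PosSemidef ∧ (ω l).trace = 1) ∧
    ∀ x a i j, σ x a i j = ∫ l, (r x a l : ℂ) * ω l i j ∂μ

/-- The steering robustness: the least `s ≥ 0` such that mixing with weight `s` of some
assemblage `τ` makes `ρ` unsteerable. -/
def steeringRobustness {n o d : ℕ} (ρ : OpFamily n o d) : ℝ :=
  sInf {s : ℝ | 0 ≤ s ∧ ∃ τ : OpFamily n o d, IsAssemblage τ ∧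
    IsUnsteerable fun x a => ((1 + s : ℝ) : ℂ)⁻¹ • (ρ x a + (s : ℂ) • τ x a)}

/-- The deterministic response function `D(a|x,l) = δ_{a,l(x)}`. -/
def detResponse {n o : ℕ} (l : Fin n → Fin o) (x : Fin n) (a : Fin o) : ℂ :=
  if a = l x then 1 else 0

/-- Feasibility in the dual semidefinite program of the steering robustness: `F_{a|x} ≥ 0` and
`∑_{a,x} D(a|x,l) F_{a|x} ≤ 1` for every deterministic strategy `l`. -/
def IsDualFeasible {n o d : ℕ} (F : OpFamily n o d) : Prop :=
  (∀ x a, (F x a).PosSemidef) ∧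
    ∀ l : Fin n → Fin o, (1 - ∑ x, ∑ a, detResponse l x a • F x a).PosSemidef

/-- The thermal state `e^{-βH} / Tr e^{-βH}`. -/
def gibbs {d : ℕ} (β : ℝ) (H : Matrix (Fin d) (Fin d) ℂ) : Matrix (Fin d) (Fin d) ℂ :=
  (NormedSpace.exp (-(β : ℂ) • H)).trace⁻¹ • NormedSpace.exp (-(β : ℂ) • H)

/-- The average heat withdrawn,
`Q_c = (1/n) ∑_{a,x} (Tr (H_{a|x} ρ_{a|x}) - p(a|x) Tr (H_{a|x} γ_{a|x}))`,
with `p(a|x) = Tr ρ_{a|x}` and `γ_{a|x}` the thermal state of `H_{a|x}`. -/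
def heat {n o d : ℕ} (β : ℝ) (ρ H : OpFamily n o d) : ℝ :=
  (1 / (n : ℝ)) * ∑ x, ∑ a, ((H x a * ρ x a).trace.re -
    (ρ x a).trace.re * (H x a * gibbs β (H x a)).trace.re)

/-- The unsteerable assemblages with the same outcome probabilities as `ρ`. -/
def unsteerableWith {n o d : ℕ} (ρ : OpFamily n o d) : Set (OpFamily n o d) :=
  {σ | IsUnsteerable σ ∧ ∀ x a, (σ x a).trace = (ρ x a).trace}

/-- The largest heat that unsteerable assemblages with the outcome probabilities of `ρ` can
withdraw with the Hamiltonians `H`. -/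
def classicalHeat {n o d : ℕ} (β : ℝ) (ρ H : OpFamily n o d) : ℝ :=
  sSup ((fun σ => heat β σ H) '' unsteerableWith ρ)

/-- The maximal advantage `ξ_max`: the supremum, over all families of Hamiltonians (Hermitian
operators) for which the ratio makes sense, of the ratio of the heat withdrawn with `ρ` to the
largest heat withdrawn with unsteerable assemblages. -/
def xiMax {n o d : ℕ} (β : ℝ) (ρ : OpFamily n o d) : EReal :=
  ⨆ H ∈ {H : OpFamily n o d | (∀ x a, (H x a).IsHermitian) ∧ 0 < classicalHeat β ρ H},
    ((heat β ρ H / classicalHeat β ρ H : ℝ) : EReal)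

/-- `n` mutually unbiased orthonormal bases of `ℂ^d`; `φ x a` is the `a`-th vector of the
`x`-th basis. -/
def IsMUB {n d : ℕ} (φ : Fin n → Fin d → EuclideanSpace ℂ (Fin d)) : Prop :=
  ∀ x y a b, ‖inner ℂ (φ x a) (φ y b)‖ =
    if x = y then (if a = b then 1 else 0) else 1 / Real.sqrt d

/-- The operator `|v⟩⟨v|`. -/
def ketbra {d : ℕ} (v : EuclideanSpace ℂ (Fin d)) : Matrix (Fin d) (Fin d) ℂ :=
  Matrix.of fun i j => v i * star (v j)

/-- `ρ_{a|x}(η) = η |φ^a_x⟩⟨φ^a_x| / d + (1 - η) I / d²`. -/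
def isotropicAssemblage {n d : ℕ} (φ : Fin n → Fin d → EuclideanSpace ℂ (Fin d)) (η : ℝ) :
    OpFamily n d d :=
  fun x a => ((η / d : ℝ) : ℂ) • ketbra (φ x a) + (((1 - η) / d ^ 2 : ℝ) : ℂ) • 1

/-- `|φ^a_x⟩⟨φ^a_x| / d`, the assemblage from the maximally entangled state. -/
def maxEntAssemblage {n d : ℕ} (φ : Fin n → Fin d → EuclideanSpace ℂ (Fin d)) :
    OpFamily n d d :=
  fun x a => ((1 / d : ℝ) : ℂ) • ketbra (φ x a)

/-- `F_{a|x} = |φ^a_x⟩⟨φ^a_x| / (1 + √d)`. -/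
def mubWitness {n d : ℕ} (φ : Fin n → Fin d → EuclideanSpace ℂ (Fin d)) : OpFamily n d d :=
  fun x a => ((1 / (1 + Real.sqrt d) : ℝ) : ℂ) • ketbra (φ x a)

/-- The lower bound on the robustness, as a function of a real dimension parameter. -/
def robustnessBound (D η : ℝ) : ℝ :=
  Real.sqrt D * ((Real.sqrt D - 1) / (Real.sqrt D + 1)) * η -
    (D * Real.sqrt D - 1) / (D * (Real.sqrt D + 1)) * (1 - η)

/-- The lower bound on `ξ_max`, as a function of a real dimension parameter. -/
def xiBound (D η : ℝ) : ℝ := (D + 1) * (1 + η * (D - 1)) / (D * (1 + Real.sqrt D))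

/-- The threshold `1 / (√D + 1 / (D + √D + 1))` for `η`. -/
def etaThreshold (D : ℝ) : ℝ := 1 / (Real.sqrt D + 1 / (D + Real.sqrt D + 1))

end Cooling

end

/-! Both lower bounds come from one witness, the basis projections divided by 1 + √d. One vector
from each of the d + 1 bases gives a Gram matrix with 1 on the diagonal and entries of modulus 1/√d
elsewhere, so every absolute row sum is 1 + d/√d = 1 + √d. By the Schur test
(`sum_norm_inner_sq_le`) the projections onto these vectors sum to at most (1 + √d) I, which is dual
feasibility. A dual-feasible functional is at most 1 on unsteerable assemblages
(`IsDualFeasible.sum_trace_le_one`), while on the isotropic assemblage this one equals `xiBound`,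
that is 1 + `robustnessBound`. Weak duality gives the robustness bound.

For `xiMax`, take E times the basis projections as Hamiltonians. The heat is then a multiple of the
same functional minus a thermal term that vanishes as E → ∞, so the heat ratio is at least `xiBound`
up to a vanishing error. Finiteness uses that visibility η/n is unsteerable: heat is affine in the
visibility and nonnegative at visibility 0, so this classical competitor already withdraws 1/n of
the heat at η.

The threshold and the growth in D are calculus in s = √D, where the bound is a rational function and
a single factor carries its sign. -/

noncomputable section

namespace Cooling

open Matrix

/-! ### Positive semidefinite matrices, rank-one projections and the Schur test. -/

section Matrices

variable {d : ℕ}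

open scoped MatrixOrder in
theorem trace_mul_posSemidef_nonneg {A B : Matrix (Fin d) (Fin d) ℂ} (hA : A.PosSemidef)
    (hB : B.PosSemidef) : 0 ≤ (A * B).trace := by
  obtain ⟨C, rfl⟩ : ∃ C : Matrix (Fin d) (Fin d) ℂ, A = Cᴴ * C :=
    CStarAlgebra.nonneg_iff_eq_star_mul_self.mp hA.nonneg
  rw [Matrix.mul_assoc, Matrix.trace_mul_comm]
  exact (hB.mul_mul_conjTranspose_same C).trace_nonneg

/-- A nonnegative principal 2 × 2 minor gives |ω_ij|² ≤ ω_ii ω_jj ≤ 1. This uniform bound makes the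
entries of a hidden-state model integrable. -/
theorem norm_entry_le_one {ω : Matrix (Fin d) (Fin d) ℂ} (hω : ω.PosSemidef) (ht : ω.trace = 1)
    (i j : Fin d) : ‖ω i j‖ ≤ 1 := by
  have hdiag : ∀ k, 0 ≤ (ω k k).re ∧ (ω k k).im = 0 := fun k => by
    have := Complex.nonneg_iff.mp (hω.diag_nonneg (i := k))
    exact ⟨this.1, this.2.symm⟩
  have hle : ∀ k, (ω k k).re ≤ 1 := fun k => by
    have h1 : ∑ k, (ω k k).re = 1 := by
      have := congrArg Complex.re ht
      simpa [Matrix.trace] using this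
    rw [← h1]
    exact Finset.single_le_sum (f := fun k => (ω k k).re) (fun l _ => (hdiag l).1)
      (Finset.mem_univ k)
  have hdet := (hω.submatrix ![i, j]).det_nonneg
  rw [Matrix.det_fin_two] at hdet
  simp only [submatrix_apply, cons_val_zero, cons_val_one] at hdet
  have hji : ω j i = star (ω i j) := (hω.isHermitian.apply j i).symm
  rw [hji, Complex.star_def, Complex.mul_conj] at hdet
  have hre := (Complex.nonneg_iff.mp hdet).1
  simp only [Complex.sub_re, Complex.mul_re, (hdiag i).2, (hdiag j).2, Complex.ofReal_re,
    mul_zero, sub_zero] at hre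
  have h2 : ‖ω i j‖ ^ 2 ≤ 1 := by
    rw [← Complex.normSq_eq_norm_sq]
    nlinarith [hdiag i, hdiag j, hle i, hle j]
  exact (sq_le_one_iff₀ (norm_nonneg _)).mp h2

theorem ketbra_eq_vecMulVec (v : EuclideanSpace ℂ (Fin d)) :
    ketbra v = vecMulVec v.ofLp (star v.ofLp) := by
  ext i j; rfl

theorem ketbra_posSemidef (v : EuclideanSpace ℂ (Fin d)) : (ketbra v).PosSemidef := by
  rw [ketbra_eq_vecMulVec]; exact posSemidef_vecMulVec_self_star _

theorem inner_eq_star_dotProduct (v w : EuclideanSpace ℂ (Fin d)) :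
    inner ℂ v w = star v.ofLp ⬝ᵥ w.ofLp := by
  rw [EuclideanSpace.inner_eq_star_dotProduct, dotProduct_comm]

theorem ketbra_mul_ketbra (v w : EuclideanSpace ℂ (Fin d)) :
    ketbra v * ketbra w = (inner ℂ v w : ℂ) • vecMulVec v.ofLp (star w.ofLp) := by
  rw [ketbra_eq_vecMulVec, ketbra_eq_vecMulVec, vecMulVec_mul_vecMulVec,
    inner_eq_star_dotProduct, vecMulVec_smul]

theorem trace_ketbra (v : EuclideanSpace ℂ (Fin d)) :
    (ketbra v).trace = ((‖v‖ ^ 2 : ℝ) : ℂ) := by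
  rw [ketbra_eq_vecMulVec, trace_vecMulVec, dotProduct_comm, ← inner_eq_star_dotProduct,
    inner_self_eq_norm_sq_to_K]
  simp

theorem star_dotProduct_ketbra_mulVec (v w : EuclideanSpace ℂ (Fin d)) :
    star w.ofLp ⬝ᵥ ketbra v *ᵥ w.ofLp = ((‖inner ℂ v w‖ ^ 2 : ℝ) : ℂ) := by
  rw [ketbra_eq_vecMulVec, vecMulVec_mulVec, op_smul_eq_smul, dotProduct_smul,
    ← inner_eq_star_dotProduct, ← inner_eq_star_dotProduct, smul_eq_mul]
  rw [← inner_conj_symm w v, Complex.mul_conj, Complex.normSq_eq_norm_sq]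

theorem ketbra_mul_self {v : EuclideanSpace ℂ (Fin d)} (hv : ‖v‖ = 1) :
    ketbra v * ketbra v = ketbra v := by
  rw [ketbra_mul_ketbra, inner_self_eq_norm_sq_to_K, hv, ← ketbra_eq_vecMulVec]
  simp

/-- The rank-one projections onto an orthonormal family of `d` vectors resolve the identity. -/
theorem sum_ketbra_eq_one {e : Fin d → EuclideanSpace ℂ (Fin d)} (he : Orthonormal ℂ e) :
    ∑ a, ketbra (e a) = 1 := by
  let U : Matrix (Fin d) (Fin d) ℂ := Matrix.of fun i a => e a i
  have h1 : Uᴴ * U = 1 := by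
    ext a b
    have := (orthonormal_iff_ite.mp he) a b
    rw [inner_eq_star_dotProduct] at this
    rw [Matrix.one_apply, ← this]
    rfl
  rw [← mul_eq_one_comm.mp h1]
  ext i j
  simp [Matrix.sum_apply, Matrix.mul_apply, U, ketbra]

/-- The complement of a rank-one projection is positive semidefinite. -/
theorem one_sub_ketbra_posSemidef {v : EuclideanSpace ℂ (Fin d)} (hv : ‖v‖ = 1) :
    (1 - ketbra v).PosSemidef := by
  have hh : (1 - ketbra v)ᴴ = 1 - ketbra v := by
    rw [conjTranspose_sub, conjTranspose_one, (ketbra_posSemidef v).isHermitian]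
  have : 1 - ketbra v = (1 - ketbra v)ᴴ * (1 - ketbra v) := by
    rw [hh, Matrix.sub_mul, Matrix.mul_sub, Matrix.mul_sub, ketbra_mul_self hv]; simp
  rw [this]
  exact posSemidef_conjTranspose_mul_self _

/-- The Schur test for the frame operator of unit vectors. -/
theorem sum_norm_inner_sq_le {n : ℕ} (v : Fin n → EuclideanSpace ℂ (Fin d)) {c : ℝ}
    (hc : 0 ≤ c) (hv : ∀ x, ∑ y, ‖inner ℂ (v x) (v y)‖ ≤ c) (w : EuclideanSpace ℂ (Fin d)) :
    ∑ x, ‖inner ℂ (v x) w‖ ^ 2 ≤ c * ‖w‖ ^ 2 := by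
  set t : Fin n → ℂ := fun x => inner ℂ (v x) w with ht
  -- `u` is the frame operator applied to `w`, so ⟨u, w⟩ = S and S² ≤ ‖u‖² ‖w‖². Expanding ‖u‖² and
  -- using 2|t_x||t_y| ≤ |t_x|² + |t_y|² with the row sums gives ‖u‖² ≤ c S; one factor S then
  -- cancels.
  set u := ∑ x, t x • v x with hu
  set S := ∑ x, ‖t x‖ ^ 2 with hS
  have hS0 : 0 ≤ S := Finset.sum_nonneg fun _ _ => sq_nonneg _
  have huw : inner ℂ u w = (S : ℂ) := by
    rw [hu, sum_inner, hS, Complex.ofReal_sum]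
    refine Finset.sum_congr rfl fun x _ => ?_
    rw [inner_smul_left, mul_comm, ← Complex.normSq_eq_norm_sq, ← Complex.mul_conj]
  have hSle : S ≤ ‖u‖ * ‖w‖ := by
    have := norm_inner_le_norm (𝕜 := ℂ) u w
    rwa [huw, Complex.norm_real, Real.norm_of_nonneg hS0] at this
  have huu : ‖u‖ ^ 2 ≤ c * S := by
    have h1 : ‖u‖ ^ 2 = ‖inner ℂ u u‖ := by
      rw [inner_self_eq_norm_sq_to_K]; simp
    have h2 : inner ℂ u u = ∑ x, ∑ y, star (t x) * t y * inner ℂ (v x) (v y) := by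
      rw [hu, sum_inner]
      refine Finset.sum_congr rfl fun x _ => ?_
      rw [inner_sum]
      refine Finset.sum_congr rfl fun y _ => ?_
      rw [inner_smul_left, inner_smul_right, ← mul_assoc]; rfl
    have h3 : ∀ x y, ‖star (t x) * t y * inner ℂ (v x) (v y)‖ ≤
        (‖t x‖ ^ 2 * ‖inner ℂ (v x) (v y)‖ + ‖t y‖ ^ 2 * ‖inner ℂ (v y) (v x)‖) / 2 := by
      intro x y
      rw [norm_mul, norm_mul, norm_star, norm_inner_symm (v y) (v x)]
      nlinarith [sq_nonneg (‖t x‖ - ‖t y‖), norm_nonneg (inner ℂ (v x) (v y))]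
    have h4 : ∑ x, ∑ y, ‖t x‖ ^ 2 * ‖inner ℂ (v x) (v y)‖ ≤ c * S := by
      rw [hS, Finset.mul_sum]
      refine Finset.sum_le_sum fun x _ => ?_
      rw [← Finset.mul_sum, mul_comm]
      exact mul_le_mul_of_nonneg_right (hv x) (sq_nonneg _)
    calc ‖u‖ ^ 2 = ‖∑ x, ∑ y, star (t x) * t y * inner ℂ (v x) (v y)‖ := by rw [h1, h2]
      _ ≤ ∑ x, ∑ y, ‖star (t x) * t y * inner ℂ (v x) (v y)‖ :=
        (norm_sum_le _ _).trans (Finset.sum_le_sum fun x _ => norm_sum_le _ _)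
      _ ≤ ∑ x, ∑ y, (‖t x‖ ^ 2 * ‖inner ℂ (v x) (v y)‖ +
            ‖t y‖ ^ 2 * ‖inner ℂ (v y) (v x)‖) / 2 :=
        Finset.sum_le_sum fun x _ => Finset.sum_le_sum fun y _ => h3 x y
      _ = ∑ x, ∑ y, ‖t x‖ ^ 2 * ‖inner ℂ (v x) (v y)‖ := by
        simp only [← Finset.sum_div, Finset.sum_add_distrib]
        rw [Finset.sum_comm (f := fun x y => ‖t y‖ ^ 2 * ‖inner ℂ (v y) (v x)‖)]
        ring
      _ ≤ c * S := h4
  have hsq : S * S ≤ (c * ‖w‖ ^ 2) * S := by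
    have h5 : S ^ 2 ≤ (‖u‖ * ‖w‖) ^ 2 := pow_le_pow_left₀ hS0 hSle 2
    nlinarith [mul_le_mul_of_nonneg_right huu (sq_nonneg ‖w‖)]
  rcases hS0.eq_or_lt with h0 | hpos
  · rw [← h0]
    positivity
  · exact le_of_mul_le_mul_right hsq hpos

end Matrices

/-! ### Weak duality between steering witnesses and local-hidden-state models. -/

section Duality

variable {n o d : ℕ}

theorem sum_detResponse_smul (F : OpFamily n o d) (l : Fin n → Fin o) (x : Fin n) :
    ∑ a, detResponse l x a • F x a = F x (l x) := by
  simp [detResponse, ite_smul]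

/-- The dual constraints, tested on a density operator and an arbitrary response function. -/
theorem IsDualFeasible.sum_response_le_one {F : OpFamily n o d} (hF : IsDualFeasible F)
    {ω : Matrix (Fin d) (Fin d) ℂ} (hω : ω.PosSemidef) (ht : ω.trace = 1)
    {r : Fin n → Fin o → ℝ} (hr : ∀ x a, 0 ≤ r x a) (hr1 : ∀ x, ∑ a, r x a = 1) :
    ∑ x, ∑ a, r x a * (F x a * ω).trace.re ≤ 1 := by
  -- For a fixed hidden state, a random response does no better than always giving the best outcome,
  -- and that deterministic strategy is covered by a dual constraint.
  have hmax : ∀ x, ∃ b, ∀ a, (F x a * ω).trace.re ≤ (F x b * ω).trace.re := by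
    intro x
    have hne : (Finset.univ : Finset (Fin o)).Nonempty := by
      rw [Finset.nonempty_iff_ne_empty]
      intro h
      have := hr1 x
      rw [h, Finset.sum_empty] at this
      exact zero_ne_one this
    obtain ⟨b, -, hb⟩ := Finset.exists_max_image Finset.univ
      (fun a => (F x a * ω).trace.re) hne
    exact ⟨b, fun a => hb a (Finset.mem_univ a)⟩
  choose l hl using hmax
  have hfeas := (Complex.nonneg_iff.mp (trace_mul_posSemidef_nonneg (hF.2 l) hω)).1
  simp only [sum_detResponse_smul, Matrix.sub_mul, Matrix.one_mul, trace_sub, ht, Matrix.sum_mul,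
    trace_sum, Complex.sub_re, Complex.one_re, Complex.re_sum] at hfeas
  calc ∑ x, ∑ a, r x a * (F x a * ω).trace.re
      ≤ ∑ x, ∑ a, r x a * (F x (l x) * ω).trace.re :=
        Finset.sum_le_sum fun x _ => Finset.sum_le_sum fun a _ =>
          mul_le_mul_of_nonneg_left (hl x a) (hr x a)
    _ = ∑ x, (F x (l x) * ω).trace.re := by simp only [← Finset.sum_mul, hr1, one_mul]
    _ ≤ 1 := by linarith

theorem trace_mul_eq_sum (A B : Matrix (Fin d) (Fin d) ℂ) :
    (A * B).trace = ∑ i, ∑ j, A i j * B j i := rfl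

/-- A dual-feasible family takes values at most one on unsteerable assemblages. -/
theorem IsDualFeasible.sum_trace_le_one {F σ : OpFamily n o d} (hF : IsDualFeasible F)
    (hσ : IsUnsteerable σ) : ∑ x, ∑ a, (F x a * σ x a).trace.re ≤ 1 := by
  obtain ⟨Λ, _, μ, r, ω, hμ, hrm, hr0, hr1, hωm, hω, hσ⟩ := hσ
  have hrle : ∀ x a l, r x a l ≤ 1 := fun x a l => by
    rw [← hr1 x l]
    exact Finset.single_le_sum (f := fun a => r x a l) (fun b _ => hr0 x b l) (Finset.mem_univ a)
  have hint : ∀ x a i j, MeasureTheory.Integrable (fun l => (r x a l : ℂ) * ω l i j) μ := by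
    intro x a i j
    refine MeasureTheory.Integrable.of_bound
      ((Complex.measurable_ofReal.comp (hrm x a)).mul (hωm i j)).aestronglyMeasurable 1
      (Eventually.of_forall fun l => ?_)
    rw [norm_mul, Complex.norm_real, Real.norm_of_nonneg (hr0 x a l)]
    exact mul_le_one₀ (hrle x a l) (norm_nonneg _) (norm_entry_le_one (hω l).1 (hω l).2 i j)
  -- The model is given entry by entry, so the trace is expanded into entries before sums and
  -- integral are exchanged.
  have hterm : ∀ x a l, (r x a l : ℂ) * (F x a * ω l).trace =
      ∑ i, ∑ j, F x a i j * ((r x a l : ℂ) * ω l j i) := by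
    intro x a l
    rw [trace_mul_eq_sum, Finset.mul_sum]
    refine Finset.sum_congr rfl fun i _ => ?_
    rw [Finset.mul_sum]
    exact Finset.sum_congr rfl fun j _ => by ring
  have hintr : ∀ x a, MeasureTheory.Integrable
      (fun l => (r x a l : ℂ) * (F x a * ω l).trace) μ := by
    intro x a
    simp only [hterm]
    exact MeasureTheory.integrable_finsetSum _ fun i _ =>
      MeasureTheory.integrable_finsetSum _ fun j _ => (hint x a j i).const_mul _
  have htr : ∀ x a, (F x a * σ x a).trace = ∫ l, (r x a l : ℂ) * (F x a * ω l).trace ∂μ := by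
    intro x a
    simp only [hterm]
    calc (F x a * σ x a).trace
        = ∑ i, ∑ j, ∫ l, F x a i j * ((r x a l : ℂ) * ω l j i) ∂μ := by
          rw [trace_mul_eq_sum]
          refine Finset.sum_congr rfl fun i _ => Finset.sum_congr rfl fun j _ => ?_
          rw [MeasureTheory.integral_const_mul, hσ x a j i]
      _ = ∑ i, ∫ l, ∑ j, F x a i j * ((r x a l : ℂ) * ω l j i) ∂μ :=
          Finset.sum_congr rfl fun i _ =>
            (MeasureTheory.integral_finsetSum _ fun j _ => (hint x a j i).const_mul _).symm
      _ = _ := (MeasureTheory.integral_finsetSum _ fun i _ =>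
          MeasureTheory.integrable_finsetSum _ fun j _ => (hint x a j i).const_mul _).symm
  have hre : ∀ x a, (F x a * σ x a).trace.re =
      ∫ l, r x a l * (F x a * ω l).trace.re ∂μ := by
    intro x a
    rw [htr, ← RCLike.re_eq_complex_re, ← integral_re (hintr x a)]
    simp
  have hintre : ∀ x a, MeasureTheory.Integrable
      (fun l => r x a l * (F x a * ω l).trace.re) μ := by
    intro x a
    have := (hintr x a).re
    simpa using this
  simp only [hre]
  calc ∑ x, ∑ a, ∫ l, r x a l * (F x a * ω l).trace.re ∂μ
      = ∫ l, ∑ x, ∑ a, r x a l * (F x a * ω l).trace.re ∂μ := by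
        rw [MeasureTheory.integral_finsetSum _ fun x _ =>
          MeasureTheory.integrable_finsetSum _ fun a _ => hintre x a]
        exact Finset.sum_congr rfl fun x _ =>
          (MeasureTheory.integral_finsetSum _ fun a _ => hintre x a).symm
    _ ≤ ∫ _, (1 : ℝ) ∂μ := by
        refine MeasureTheory.integral_mono
          (MeasureTheory.integrable_finsetSum _ fun x _ =>
            MeasureTheory.integrable_finsetSum _ fun a _ => hintre x a)
          (MeasureTheory.integrable_const _) fun l => ?_
        exact hF.sum_response_le_one (hω l).1 (hω l).2 (fun x a => hr0 x a l)
          fun x => hr1 x l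
    _ = 1 := by simp

/-- Weak duality for the steering robustness. -/
theorem IsDualFeasible.sum_trace_sub_one_le_steeringRobustness {F ρ : OpFamily n o d}
    (hF : IsDualFeasible F)
    (hne : ∃ s : ℝ, 0 ≤ s ∧ ∃ τ : OpFamily n o d, IsAssemblage τ ∧
      IsUnsteerable fun x a => ((1 + s : ℝ) : ℂ)⁻¹ • (ρ x a + (s : ℂ) • τ x a)) :
    ∑ x, ∑ a, (F x a * ρ x a).trace.re - 1 ≤ steeringRobustness ρ := by
  -- Nonemptiness matters: in ℝ the infimum of the empty set is 0.
  refine le_csInf hne ?_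
  rintro s ⟨hs, τ, hτ, hu⟩
  have h1 := hF.sum_trace_le_one hu
  have h2 : ∀ x a, (F x a * (((1 + s : ℝ) : ℂ)⁻¹ • (ρ x a + (s : ℂ) • τ x a))).trace.re =
      (1 + s)⁻¹ * ((F x a * ρ x a).trace.re + s * (F x a * τ x a).trace.re) := by
    intro x a
    rw [← Complex.ofReal_inv, Matrix.mul_smul, trace_smul, Matrix.mul_add, trace_add,
      Matrix.mul_smul, trace_smul, smul_eq_mul, smul_eq_mul, Complex.re_ofReal_mul, Complex.add_re,
      Complex.re_ofReal_mul]
  simp only [h2, ← Finset.mul_sum, Finset.sum_add_distrib] at h1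
  -- Since F ≥ 0, the admixed τ only adds to the value, which leaves ∑ Tr(Fρ) ≤ 1 + s.
  have h3 : 0 ≤ ∑ x, ∑ a, (F x a * τ x a).trace.re :=
    Finset.sum_nonneg fun x _ => Finset.sum_nonneg fun a _ =>
      (Complex.nonneg_iff.mp (trace_mul_posSemidef_nonneg (hF.1 x a) (hτ.1 x a))).1
  rw [inv_mul_le_iff₀ (by linarith)] at h1
  nlinarith [mul_nonneg hs h3]

end Duality

/-! ### The witness and the isotropic assemblages of mutually unbiased bases. -/

section MutuallyUnbiased

variable {n d : ℕ} {φ : Fin n → Fin d → EuclideanSpace ℂ (Fin d)}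

theorem IsMUB.norm_eq_one (hφ : IsMUB φ) (x : Fin n) (a : Fin d) : ‖φ x a‖ = 1 := by
  have h := hφ x x a a
  rw [if_pos rfl, if_pos rfl, inner_self_eq_norm_sq_to_K] at h
  have h2 : ‖φ x a‖ ^ 2 = 1 := by simpa using h
  exact (pow_eq_one_iff_of_nonneg (norm_nonneg _) two_ne_zero).mp h2

theorem IsMUB.orthonormal (hφ : IsMUB φ) (x : Fin n) : Orthonormal ℂ (φ x) := by
  refine ⟨hφ.norm_eq_one x, fun a b hab => ?_⟩
  have h := hφ x x a b
  rw [if_pos rfl, if_neg hab] at h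
  exact norm_eq_zero.mp h

theorem IsMUB.sum_ketbra (hφ : IsMUB φ) (x : Fin n) : ∑ a, ketbra (φ x a) = 1 :=
  sum_ketbra_eq_one (hφ.orthonormal x)

theorem IsMUB.trace_ketbra (hφ : IsMUB φ) (x : Fin n) (a : Fin d) :
    (ketbra (φ x a)).trace = 1 := by
  rw [Cooling.trace_ketbra, hφ.norm_eq_one]; simp

theorem posSemidef_ofReal_smul {A : Matrix (Fin d) (Fin d) ℂ} (hA : A.PosSemidef) {c : ℝ}
    (hc : 0 ≤ c) : ((c : ℂ) • A).PosSemidef :=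
  hA.smul (by exact_mod_cast hc)

theorem isotropicAssemblage_posSemidef (φ : Fin n → Fin d → EuclideanSpace ℂ (Fin d)) {η : ℝ}
    (hη0 : 0 ≤ η) (hη1 : η ≤ 1) (x : Fin n) (a : Fin d) :
    (isotropicAssemblage φ η x a).PosSemidef :=
  (posSemidef_ofReal_smul (ketbra_posSemidef _) (by positivity)).add
    (posSemidef_ofReal_smul PosSemidef.one (div_nonneg (by linarith) (by positivity)))

/-- The value does not depend on η, so isotropic assemblages of all visibilities share their outcome
probabilities and can be compared in `unsteerableWith`. -/
theorem IsMUB.trace_isotropicAssemblage (hφ : IsMUB φ) (hd : 0 < d) (η : ℝ) (x : Fin n)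
    (a : Fin d) : (isotropicAssemblage φ η x a).trace = ((1 / d : ℝ) : ℂ) := by
  have hd' : (d : ℂ) ≠ 0 := by exact_mod_cast hd.ne'
  rw [isotropicAssemblage, trace_add, trace_smul, trace_smul, hφ.trace_ketbra, trace_one]
  simp only [smul_eq_mul, Fintype.card_fin]
  push_cast
  field_simp
  ring

theorem IsMUB.isAssemblage_isotropicAssemblage (hφ : IsMUB φ) (hd : 0 < d) {η : ℝ} (hη0 : 0 ≤ η)
    (hη1 : η ≤ 1) : IsAssemblage (isotropicAssemblage φ η) := by
  have hd' : (d : ℂ) ≠ 0 := by exact_mod_cast hd.ne'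
  refine ⟨isotropicAssemblage_posSemidef φ hη0 hη1, ((1 / d : ℝ) : ℂ) • 1, ?_, fun x => ?_⟩
  · rw [trace_smul, trace_one]
    simp [hd']
  · simp only [isotropicAssemblage, Finset.sum_add_distrib, ← Finset.smul_sum, hφ.sum_ketbra,
      Finset.sum_const, Finset.card_univ, Fintype.card_fin]
    rw [← Nat.cast_smul_eq_nsmul ℂ, smul_smul, ← add_smul]
    congr 1
    push_cast
    field_simp
    ring

theorem IsMUB.isDualFeasible_mubWitness {φ : Fin (d + 1) → Fin d → EuclideanSpace ℂ (Fin d)}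
    (hφ : IsMUB φ) : IsDualFeasible (mubWitness φ) := by
  have hs : 0 < 1 + √(d : ℝ) := by positivity
  have hpsd : ∀ x a, (mubWitness φ x a).PosSemidef := fun x a =>
    posSemidef_ofReal_smul (ketbra_posSemidef _) (by positivity)
  refine ⟨hpsd, fun l => ?_⟩
  simp only [sum_detResponse_smul]
  refine PosSemidef.of_dotProduct_mulVec_nonneg
    (isHermitian_one.sub (posSemidef_sum _ fun x _ => hpsd x (l x)).isHermitian) fun w => ?_
  have hrow : ∀ x, ∑ y, ‖inner ℂ (φ x (l x)) (φ y (l y))‖ ≤ 1 + √(d : ℝ) := by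
    intro x
    -- Writing the diagonal entry as 1/√d plus a correction makes the row sum (d + 1)/√d + 1 − 1/√d
    -- = 1 + √d.
    have h : ∀ y, ‖inner ℂ (φ x (l x)) (φ y (l y))‖ =
        1 / √(d : ℝ) + if x = y then 1 - 1 / √(d : ℝ) else 0 := by
      intro y
      rw [hφ]
      by_cases hxy : x = y
      · subst hxy; simp
      · simp [hxy]
    simp only [h, Finset.sum_add_distrib, Finset.sum_ite_eq, Finset.mem_univ, if_true,
      Finset.sum_const, Finset.card_univ, Fintype.card_fin, nsmul_eq_mul]
    push_cast
    have : (d : ℝ) * (1 / √(d : ℝ)) = √(d : ℝ) := by rw [mul_one_div, Real.div_sqrt]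
    linarith
  have hsch := sum_norm_inner_sq_le (fun x => φ x (l x)) hs.le hrow (WithLp.toLp 2 w)
  have hval : star w ⬝ᵥ (1 - ∑ x, mubWitness φ x (l x)) *ᵥ w =
      ((‖WithLp.toLp 2 w‖ ^ 2 - 1 / (1 + √(d : ℝ)) *
        ∑ x, ‖inner ℂ (φ x (l x)) (WithLp.toLp 2 w)‖ ^ 2 : ℝ) : ℂ) := by
    have h1 : star w ⬝ᵥ w = ((‖WithLp.toLp 2 w‖ ^ 2 : ℝ) : ℂ) := by
      have := inner_self_eq_norm_sq_to_K (𝕜 := ℂ) (WithLp.toLp 2 w)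
      rw [inner_eq_star_dotProduct] at this
      rw [this]; simp
    have h2 : ∀ x, star w ⬝ᵥ mubWitness φ x (l x) *ᵥ w = ((1 / (1 + √(d : ℝ)) *
        ‖inner ℂ (φ x (l x)) (WithLp.toLp 2 w)‖ ^ 2 : ℝ) : ℂ) := by
      intro x
      have := star_dotProduct_ketbra_mulVec (φ x (l x)) (WithLp.toLp 2 w)
      rw [mubWitness, smul_mulVec, dotProduct_smul, this, smul_eq_mul, ← Complex.ofReal_mul]
    rw [sub_mulVec, one_mulVec, dotProduct_sub, h1, sum_mulVec, dotProduct_sum]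
    simp only [h2]
    rw [← Complex.ofReal_sum, ← Finset.mul_sum, ← Complex.ofReal_sub]
  rw [hval]
  have : 1 / (1 + √(d : ℝ)) * ∑ x, ‖inner ℂ (φ x (l x)) (WithLp.toLp 2 w)‖ ^ 2 ≤
      ‖WithLp.toLp 2 w‖ ^ 2 := by
    rw [one_div, inv_mul_le_iff₀ hs]; exact hsch
  exact_mod_cast sub_nonneg.mpr this

theorem IsMUB.trace_ketbra_mul_isotropicAssemblage (hφ : IsMUB φ) (η : ℝ) (x : Fin n)
    (a : Fin d) : (ketbra (φ x a) * isotropicAssemblage φ η x a).trace =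
      ((η / d + (1 - η) / d ^ 2 : ℝ) : ℂ) := by
  rw [isotropicAssemblage, Matrix.mul_add, Matrix.mul_smul, Matrix.mul_smul, Matrix.mul_one,
    ketbra_mul_self (hφ.norm_eq_one x a), trace_add, trace_smul, trace_smul, hφ.trace_ketbra]
  push_cast
  simp

theorem IsMUB.sum_trace_mubWitness_mul {φ : Fin (d + 1) → Fin d → EuclideanSpace ℂ (Fin d)}
    (hφ : IsMUB φ) (hd : 0 < d) (η : ℝ) :
    ∑ x, ∑ a, (mubWitness φ x a * isotropicAssemblage φ η x a).trace = (xiBound d η : ℂ) := by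
  have hd' : (d : ℝ) ≠ 0 := by exact_mod_cast hd.ne'
  have h : ∀ x a, (mubWitness φ x a * isotropicAssemblage φ η x a).trace =
      ((1 / (1 + √(d : ℝ)) * (η / d + (1 - η) / d ^ 2) : ℝ) : ℂ) := by
    intro x a
    rw [mubWitness, Matrix.smul_mul, trace_smul, hφ.trace_ketbra_mul_isotropicAssemblage,
      smul_eq_mul, ← Complex.ofReal_mul]
  simp only [h, Finset.sum_const, Finset.card_univ, Fintype.card_fin, nsmul_eq_mul]
  rw [← Complex.ofReal_natCast, ← Complex.ofReal_natCast, ← Complex.ofReal_mul,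
    ← Complex.ofReal_mul, xiBound]
  congr 1
  push_cast
  field_simp
  ring

/-- A local-hidden-state model with a uniformly distributed finite hidden variable. -/
theorem isUnsteerable_of_fintype {o : ℕ} {Λ : Type} [Fintype Λ] [Nonempty Λ]
    {σ : OpFamily n o d} {r : Fin n → Fin o → Λ → ℝ} {ω : Λ → Matrix (Fin d) (Fin d) ℂ}
    (hr0 : ∀ x a l, 0 ≤ r x a l) (hr1 : ∀ x l, ∑ a, r x a l = 1)
    (hω : ∀ l, (ω l).PosSemidef ∧ (ω l).trace = 1)
    (hσ : ∀ x a, σ x a = (Fintype.card Λ : ℂ)⁻¹ • ∑ l, (r x a l : ℂ) • ω l) :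
    IsUnsteerable σ := by
  let _ : MeasurableSpace Λ := ⊤
  refine ⟨Λ, inferInstance, (PMF.uniformOfFintype Λ).toMeasure, r, ω, inferInstance,
    fun _ _ => measurable_from_top, hr0, hr1, fun _ _ => measurable_from_top, hω,
    fun x a i j => ?_⟩
  rw [PMF.integral_eq_sum, hσ, Matrix.smul_apply, Matrix.sum_apply, smul_eq_mul, Finset.mul_sum]
  refine Finset.sum_congr rfl fun l _ => ?_
  rw [PMF.uniformOfFintype_apply, Matrix.smul_apply, smul_eq_mul, ENNReal.toReal_inv,
    ENNReal.toReal_natCast, Complex.real_smul]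
  push_cast
  rfl

/-- The isotropic assemblages of small visibility are unsteerable: a random basis vector is sent,
and the answers to the other settings are uniformly random. -/
theorem IsMUB.isUnsteerable_isotropicAssemblage (hφ : IsMUB φ) (hn : 0 < n) (hd : 0 < d) {η : ℝ}
    (hη0 : 0 ≤ η) (hη1 : η ≤ 1) : IsUnsteerable (isotropicAssemblage φ (η / n)) := by
  have hd' : (d : ℝ) ≠ 0 := by exact_mod_cast hd.ne'
  have hn' : (n : ℝ) ≠ 0 := by exact_mod_cast hn.ne'
  have hdc : (d : ℂ) ≠ 0 := by exact_mod_cast hd.ne'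
  have hnc : (n : ℂ) ≠ 0 := by exact_mod_cast hn.ne'
  have : NeZero n := ⟨hn.ne'⟩
  have : NeZero d := ⟨hd.ne'⟩
  -- The hidden variable is a uniform pair (y, b). The state sent is the basis vector depolarised to
  -- visibility η; the queried setting matches y with probability 1/n, whence η/n.
  set ω : Fin n × Fin d → Matrix (Fin d) (Fin d) ℂ := fun l =>
    (η : ℂ) • ketbra (φ l.1 l.2) + (((1 - η) / d : ℝ) : ℂ) • 1 with hωdef
  have hωsum : ∀ y, ∑ b, ω (y, b) = 1 := by
    intro y
    simp only [hωdef, Finset.sum_add_distrib, ← Finset.smul_sum, hφ.sum_ketbra,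
      Finset.sum_const, Finset.card_univ, Fintype.card_fin]
    rw [← Nat.cast_smul_eq_nsmul ℂ, smul_smul, ← add_smul]
    convert one_smul ℂ (1 : Matrix (Fin d) (Fin d) ℂ)
    push_cast
    field_simp
    ring
  refine isUnsteerable_of_fintype (Λ := Fin n × Fin d) (ω := ω)
    (r := fun x a l => if x = l.1 then (if a = l.2 then 1 else 0) else 1 / d) ?_ ?_ ?_ ?_
  · intro x a l
    split_ifs <;> positivity
  · intro x l
    by_cases h : x = l.1
    · simp [h]
    · simp [h, hd']
  · intro l
    refine ⟨(posSemidef_ofReal_smul (ketbra_posSemidef _) hη0).add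
      (posSemidef_ofReal_smul PosSemidef.one (div_nonneg (by linarith) (by positivity))), ?_⟩
    rw [hωdef, trace_add, trace_smul, trace_smul, hφ.trace_ketbra, trace_one]
    simp only [smul_eq_mul, Fintype.card_fin]
    push_cast
    field_simp
    ring
  · intro x a
    rw [Fintype.sum_prod_type]
    -- If y differs from x, the basis sums to the identity and leaves only white noise I/d; the
    -- matching setting enters as a correction to that.
    have hin : ∀ y, ∑ b, (((if x = y then (if a = b then 1 else 0) else 1 / d : ℝ)) : ℂ) •
        ω (y, b) = ((1 / d : ℝ) : ℂ) • (1 : Matrix (Fin d) (Fin d) ℂ) +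
          if x = y then ω (x, a) - ((1 / d : ℝ) : ℂ) • 1 else 0 := by
      intro y
      by_cases h : x = y
      · subst h
        simp only [if_true, add_sub_cancel]
        rw [Finset.sum_eq_single a]
        · simp
        · intro b _ hb; simp [hb.symm]
        · simp
      · simp only [if_neg h, add_zero, ← Finset.smul_sum, hωsum]
    simp only [hin, Finset.sum_add_distrib, Finset.sum_ite_eq, Finset.mem_univ, if_true,
      Finset.sum_const, Finset.card_univ, Fintype.card_fin, Fintype.card_prod]
    rw [hωdef, isotropicAssemblage, ← Nat.cast_smul_eq_nsmul ℂ]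
    ext i j
    simp only [Matrix.add_apply, Matrix.smul_apply, Matrix.sub_apply, smul_eq_mul]
    push_cast
    field_simp
    ring

/-- Supplies the nonemptiness that weak duality needs. -/
theorem IsMUB.exists_isUnsteerable_mix (hφ : IsMUB φ) (hn : 0 < n) (hd : 1 < d) {η : ℝ}
    (hη0 : 0 ≤ η) (hη1 : η ≤ 1) : ∃ s : ℝ, 0 ≤ s ∧ ∃ τ : OpFamily n d d, IsAssemblage τ ∧
      IsUnsteerable fun x a =>
        ((1 + s : ℝ) : ℂ)⁻¹ • (isotropicAssemblage φ η x a + (s : ℂ) • τ x a) := by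
  have hd1 : (1 : ℝ) < d := by exact_mod_cast hd
  have hdc : (d : ℂ) ≠ 0 := by exact_mod_cast (show d ≠ 0 by omega)
  have hdc1 : (d : ℂ) - 1 ≠ 0 := by
    rw [sub_ne_zero]; exact_mod_cast hd.ne'
  -- τ is the complementary noise for which ρ + (d − 1)τ = I/d; dividing by 1 + s = d leaves I/d²,
  -- the isotropic assemblage of visibility 0.
  refine ⟨d - 1, by linarith, fun x a => ((η / (d * (d - 1)) : ℝ) : ℂ) • (1 - ketbra (φ x a)) +
    (((1 - η) / d ^ 2 : ℝ) : ℂ) • 1, ⟨fun x a => ?_, ((1 / d : ℝ) : ℂ) • 1, ?_, fun x => ?_⟩, ?_⟩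
  · exact (posSemidef_ofReal_smul (one_sub_ketbra_posSemidef (hφ.norm_eq_one x a))
      (div_nonneg hη0 (mul_nonneg (by linarith) (by linarith)))).add
      (posSemidef_ofReal_smul PosSemidef.one (div_nonneg (by linarith) (by positivity)))
  · rw [trace_smul, trace_one]
    simp [hdc]
  · simp only [Finset.sum_add_distrib, ← Finset.smul_sum, Finset.sum_sub_distrib, hφ.sum_ketbra,
      Finset.sum_const, Finset.card_univ, Fintype.card_fin]
    rw [← Nat.cast_smul_eq_nsmul ℂ]
    ext i j
    simp only [Matrix.add_apply, Matrix.smul_apply, Matrix.sub_apply, smul_eq_mul]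
    push_cast
    field_simp
    ring
  · convert hφ.isUnsteerable_isotropicAssemblage hn (by omega) le_rfl zero_le_one using 3 with x a
    rw [isotropicAssemblage, isotropicAssemblage, zero_div]
    ext i j
    simp only [Matrix.add_apply, Matrix.smul_apply, Matrix.sub_apply, smul_eq_mul]
    push_cast
    rw [add_sub_cancel]
    field_simp
    ring

theorem IsMUB.xiBound_sub_one_le_steeringRobustness
    {φ : Fin (d + 1) → Fin d → EuclideanSpace ℂ (Fin d)} (hφ : IsMUB φ) (hd : 1 < d) {η : ℝ}
    (hη0 : 0 ≤ η) (hη1 : η ≤ 1) :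
    xiBound d η - 1 ≤ steeringRobustness (isotropicAssemblage φ η) := by
  have h := hφ.isDualFeasible_mubWitness.sum_trace_sub_one_le_steeringRobustness
    (hφ.exists_isUnsteerable_mix d.succ_pos hd hη0 hη1)
  have hv := congrArg Complex.re (hφ.sum_trace_mubWitness_mul (by omega) η)
  simp only [Complex.re_sum, Complex.ofReal_re] at hv
  rwa [hv] at h

theorem isotropicAssemblage_one (φ : Fin n → Fin d → EuclideanSpace ℂ (Fin d)) :
    isotropicAssemblage φ 1 = maxEntAssemblage φ := by
  funext x a
  simp [isotropicAssemblage, maxEntAssemblage]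

end MutuallyUnbiased

/-! ### Gibbs states: projection Hamiltonians and a bound on the thermal energy. -/

section Thermal

variable {n o d : ℕ}

/-- All powers pᵏ with k ≥ 1 equal p, so the series is that of eᵗ times p, corrected by 1 − p in the
term k = 0. -/
theorem exp_smul_of_isIdempotentElem {A : Type*} [NormedRing A] [NormedAlgebra ℂ A]
    [CompleteSpace A] [Algebra ℚ A] {p : A} (hp : IsIdempotentElem p) (t : ℂ) :
    NormedSpace.exp (t • p) = 1 + (Complex.exp t - 1) • p := by
  have h1 := NormedSpace.exp_series_hasSum_exp' (𝕂 := ℂ) (t • p)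
  have h2 : HasSum (fun k : ℕ => ((k.factorial : ℂ)⁻¹ * t ^ k) • p) (Complex.exp t • p) := by
    have := NormedSpace.exp_series_hasSum_exp' (𝕂 := ℂ) t
    rw [← Complex.exp_eq_exp_ℂ] at this
    simpa only [smul_eq_mul] using this.smul_const p
  have h3 : HasSum (fun k : ℕ => if k = 0 then 1 - p else 0) (1 - p) := hasSum_ite_eq 0 (1 - p)
  have h4 := h2.add h3
  have h5 : (fun k : ℕ => (k.factorial : ℂ)⁻¹ • (t • p) ^ k) =
      fun k : ℕ => ((k.factorial : ℂ)⁻¹ * t ^ k) • p + if k = 0 then 1 - p else 0 := by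
    funext k
    rcases k with _ | k
    · simp
    · rw [smul_pow, hp.pow_succ_eq, smul_smul]; simp
  rw [h5] at h1
  rw [h1.unique h4, sub_smul, one_smul]
  abel

theorem matrix_exp_smul_of_isIdempotentElem {P : Matrix (Fin d) (Fin d) ℂ}
    (hP : IsIdempotentElem P) (t : ℂ) :
    NormedSpace.exp (t • P) = 1 + (Complex.exp t - 1) • P := by
  -- The statement involves no norm, so a submultiplicative one is chosen inside the proof.
  let _ : NormedRing (Matrix (Fin d) (Fin d) ℂ) := Matrix.linftyOpNormedRing
  let _ : NormedAlgebra ℂ (Matrix (Fin d) (Fin d) ℂ) := Matrix.linftyOpNormedAlgebra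
  exact exp_smul_of_isIdempotentElem hP t

/-- The thermal energy of a scaled rank-one projection. -/
theorem trace_smul_ketbra_mul_gibbs {v : EuclideanSpace ℂ (Fin d)} (hv : ‖v‖ = 1) (β E : ℝ) :
    ((E : ℂ) • ketbra v * gibbs β ((E : ℂ) • ketbra v)).trace.re =
      E * (Real.exp (-(β * E)) / (d - 1 + Real.exp (-(β * E)))) := by
  have htr : (ketbra v).trace = 1 := by rw [trace_ketbra, hv]; simp
  have hexp : NormedSpace.exp (-(β : ℂ) • (E : ℂ) • ketbra v) =
      1 + ((Real.exp (-(β * E)) - 1 : ℝ) : ℂ) • ketbra v := by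
    rw [smul_smul, matrix_exp_smul_of_isIdempotentElem (ketbra_mul_self hv)]
    push_cast
    rw [neg_mul]
  have hkey : ((E : ℂ) • ketbra v * gibbs β ((E : ℂ) • ketbra v)).trace =
      ((E * (Real.exp (-(β * E)) / (d - 1 + Real.exp (-(β * E)))) : ℝ) : ℂ) := by
    rw [gibbs, hexp, Matrix.mul_smul, trace_smul, Matrix.smul_mul, trace_smul, Matrix.mul_add,
      Matrix.mul_smul, Matrix.mul_one, ketbra_mul_self hv, trace_add, trace_add, trace_smul, htr,
      trace_one, Fintype.card_fin]
    simp only [smul_eq_mul]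
    push_cast
    rw [show (d : ℂ) + (Complex.exp (-(β * E)) - 1) * 1 = d - 1 + Complex.exp (-(β * E)) by ring,
      show (1 : ℂ) + (Complex.exp (-(β * E)) - 1) * 1 = Complex.exp (-(β * E)) by ring]
    rw [div_eq_mul_inv]
    ring
  rw [hkey, Complex.ofReal_re]

/-- The thermal energy is at most the average of the eigenvalues. -/
theorem trace_mul_gibbs_le {H : Matrix (Fin d) (Fin d) ℂ} (hH : H.IsHermitian) (hd : 0 < d)
    {β : ℝ} (hβ : 0 ≤ β) : (H * gibbs β H).trace.re ≤ H.trace.re / d := by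
  set U : Matrix (Fin d) (Fin d) ℂ := (hH.eigenvectorUnitary : Matrix (Fin d) (Fin d) ℂ) with hU
  set ev := hH.eigenvalues with hev
  have hUU : star U * U = 1 := Unitary.coe_star_mul_self hH.eigenvectorUnitary
  have hUU' : U * star U = 1 := Unitary.coe_mul_star_self hH.eigenvectorUnitary
  have hinv : U⁻¹ = star U := Matrix.inv_eq_right_inv hUU'
  have hunit : IsUnit U := (Matrix.isUnit_iff_isUnit_det U).mpr
    (Matrix.isUnit_det_of_right_inverse hUU')
  have hspec : H = U * diagonal (fun i => (ev i : ℂ)) * star U := hH.spectral_theorem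
  have hexp : NormedSpace.exp (-(β : ℂ) • H) =
      U * diagonal (fun i => ((Real.exp (-(β * ev i)) : ℝ) : ℂ)) * star U := by
    have h1 : -(β : ℂ) • H = U * diagonal (fun i => (-(β * ev i) : ℂ)) * U⁻¹ := by
      conv_lhs => rw [hspec]
      rw [hinv, ← Matrix.smul_mul, ← Matrix.mul_smul]
      congr 2
      ext i j
      by_cases hij : i = j
      · subst hij; simp
      · simp [hij]
    rw [h1, Matrix.exp_conj _ _ hunit, Matrix.exp_diagonal, hinv]
    congr 3
    funext i
    rw [Pi.coe_exp, ← Complex.exp_eq_exp_ℂ]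
    push_cast
    rfl
  have hconj : ∀ v : Fin d → ℂ, (U * diagonal v * star U).trace = ∑ i, v i := by
    intro v
    rw [Matrix.trace_mul_cycle, hUU, Matrix.one_mul, trace_diagonal]
  have htrE : (NormedSpace.exp (-(β : ℂ) • H)).trace =
      ((∑ i, Real.exp (-(β * ev i)) : ℝ) : ℂ) := by
    rw [hexp, hconj, Complex.ofReal_sum]
  have htrH : H.trace.re = ∑ i, ev i := by
    conv_lhs => rw [hspec]
    rw [hconj, ← Complex.ofReal_sum, Complex.ofReal_re]
  have htrHE : (H * NormedSpace.exp (-(β : ℂ) • H)).trace =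
      ((∑ i, ev i * Real.exp (-(β * ev i)) : ℝ) : ℂ) := by
    rw [hexp]
    conv_lhs => rw [hspec]
    rw [show U * diagonal (fun i => (ev i : ℂ)) * star U *
        (U * diagonal (fun i => ((Real.exp (-(β * ev i)) : ℝ) : ℂ)) * star U) =
        U * diagonal (fun i => (ev i : ℂ)) * (star U * U) *
          diagonal (fun i => ((Real.exp (-(β * ev i)) : ℝ) : ℂ)) * star U by
        simp only [Matrix.mul_assoc], hUU, Matrix.mul_one, Matrix.mul_assoc U, diagonal_mul_diagonal,
      hconj]
    push_cast
    rfl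
  have hZ : 0 < ∑ i, Real.exp (-(β * ev i)) :=
    Finset.sum_pos (fun i _ => Real.exp_pos _) ⟨⟨0, hd⟩, Finset.mem_univ _⟩
  have hcheb : (d : ℝ) * ∑ i, ev i * Real.exp (-(β * ev i)) ≤
      (∑ i, ev i) * ∑ i, Real.exp (-(β * ev i)) := by
    -- Boltzmann weights decrease as the energy grows, so Chebyshev's sum inequality compares the
    -- thermal average with the uniform one.
    have hanti : Antivary ev fun i => Real.exp (-(β * ev i)) := by
      intro i j hij
      have h1 := Real.exp_lt_exp.mp hij
      have h2 : β * ev j < β * ev i := by linarith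
      exact (lt_of_mul_lt_mul_left h2 hβ).le
    simpa using hanti.card_mul_sum_le_sum_mul_sum
  rw [gibbs, Matrix.mul_smul, trace_smul, htrE, htrHE, smul_eq_mul, ← Complex.ofReal_inv,
    ← Complex.ofReal_mul, Complex.ofReal_re, htrH, inv_mul_le_iff₀ hZ,
    ← mul_div_assoc, le_div_iff₀ (by exact_mod_cast hd)]
  linarith

end Thermal

/-! ### Calculus of the bound in a real dimension parameter. -/

section Bounds

/-- For s > 1 the second factor of the numerator decides the sign; its positivity is the threshold
condition with denominators cleared. -/
theorem robustnessBound_sq {s : ℝ} (hs : 0 < s) (η : ℝ) :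
    robustnessBound (s ^ 2) η =
      (s - 1) * (s ^ 3 * η - (s ^ 2 + s + 1) * (1 - η)) / (s ^ 2 * (s + 1)) := by
  rw [robustnessBound, Real.sqrt_sq hs.le]
  field_simp
  ring

theorem etaThreshold_sq_lt_iff {s : ℝ} (hs : 0 < s) (η : ℝ) :
    etaThreshold (s ^ 2) < η ↔ 0 < s ^ 3 * η - (s ^ 2 + s + 1) * (1 - η) := by
  have hN : 0 < s ^ 2 + s + 1 := by positivity
  rw [etaThreshold, Real.sqrt_sq hs.le]
  have : 1 / (s + 1 / (s ^ 2 + s + 1)) = (s ^ 2 + s + 1) / (s * (s ^ 2 + s + 1) + 1) := by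
    field_simp
  rw [this, div_lt_iff₀ (by positivity), ← sub_pos]
  ring_nf

theorem robustnessBound_pos_iff {D : ℝ} (hD : 1 < D) (η : ℝ) :
    0 < robustnessBound D η ↔ etaThreshold D < η := by
  have hs : 1 < √D := Real.lt_sqrt_of_sq_lt (by linarith)
  have hs0 : 0 < √D := by linarith
  rw [← Real.sq_sqrt (show 0 ≤ D by linarith), robustnessBound_sq hs0, etaThreshold_sq_lt_iff hs0,
    div_pos_iff_of_pos_right (by positivity), mul_pos_iff_of_pos_left (by linarith)]

theorem xiBound_eq {D : ℝ} (hD : 0 < D) (η : ℝ) : xiBound D η = 1 + robustnessBound D η := by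
  have hs : 0 < √D := Real.sqrt_pos.mpr hD
  rw [← Real.sq_sqrt hD.le, robustnessBound_sq hs, xiBound, Real.sqrt_sq hs.le]
  field_simp
  ring

/-- The ratio (s² + s + 1)/s³ decreases in s. Hence the regime above the threshold persists on the
whole ray from D₁, which the monotonicity argument requires. -/
theorem etaThreshold_lt_of_le {D₁ D₂ η : ℝ} (h1 : 0 < D₁) (h12 : D₁ ≤ D₂)
    (hη1 : η ≤ 1) (h : etaThreshold D₁ < η) : etaThreshold D₂ < η := by
  have hs1 : 0 < √D₁ := Real.sqrt_pos.mpr h1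
  have hs12 : √D₁ ≤ √D₂ := Real.sqrt_le_sqrt h12
  rw [← Real.sq_sqrt h1.le, etaThreshold_sq_lt_iff hs1] at h
  rw [← Real.sq_sqrt (h1.le.trans h12), etaThreshold_sq_lt_iff (hs1.trans_le hs12)]
  generalize √D₁ = s at *
  generalize √D₂ = t at *
  have ht : 0 < t := hs1.trans_le hs12
  have h3 : (t ^ 2 + t + 1) * s ^ 3 ≤ (s ^ 2 + s + 1) * t ^ 3 := by
    have e : (s ^ 2 + s + 1) * t ^ 3 - (t ^ 2 + t + 1) * s ^ 3 =
      (t - s) * (s ^ 2 * t ^ 2 + s * t * (t + s) + (t ^ 2 + t * s + s ^ 2)) := by ring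
    have : 0 ≤ (t - s) * (s ^ 2 * t ^ 2 + s * t * (t + s) + (t ^ 2 + t * s + s ^ 2)) :=
      mul_nonneg (by linarith) (by positivity)
    linarith
  have h4 : (t ^ 2 + t + 1) * s ^ 3 * (1 - η) ≤ (s ^ 2 + s + 1) * t ^ 3 * (1 - η) :=
    mul_le_mul_of_nonneg_right h3 (by linarith)
  have h5 : 0 < (s ^ 3 * η - (s ^ 2 + s + 1) * (1 - η)) * t ^ 3 := by positivity
  have h6 : 0 < (t ^ 3 * η - (t ^ 2 + t + 1) * (1 - η)) * s ^ 3 := by linarith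
  exact pos_of_mul_pos_left h6 (by positivity)

theorem hasDerivAt_robustnessBound {D η : ℝ} (hD : 1 < D) (hη1 : η ≤ 1)
    (h : etaThreshold D < η) :
    ∃ D' : ℝ, HasDerivAt (fun t => robustnessBound t η) D' D ∧ 0 < D' := by
  have hs : 1 < √D := Real.lt_sqrt_of_sq_lt (by linarith)
  have hs0 : 0 < √D := by linarith
  have hDs : D = √D ^ 2 := (Real.sq_sqrt (by linarith)).symm
  set s := √D with hsdef
  have hg : HasDerivAt (fun u : ℝ => (u - 1) * (u ^ 3 * η - (u ^ 2 + u + 1) * (1 - η)) /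
      (u ^ 2 * (u + 1)))
      (((1 * (s ^ 3 * η - (s ^ 2 + s + 1) * (1 - η)) +
        (s - 1) * (3 * s ^ 2 * η - (2 * s + 1) * (1 - η))) * (s ^ 2 * (s + 1)) -
        (s - 1) * (s ^ 3 * η - (s ^ 2 + s + 1) * (1 - η)) * (2 * s * (s + 1) + s ^ 2 * 1)) /
          (s ^ 2 * (s + 1)) ^ 2) s := by
    have hid := hasDerivAt_id' s
    refine HasDerivAt.div ?_ ?_ (by positivity)
    · refine (hid.sub_const 1).mul ?_
      have := ((hid.pow 3).mul_const η).sub ((((hid.pow 2).add hid).add_const 1).mul_const (1 - η))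
      exact this.congr_deriv (by norm_num)
    · have := (hid.pow 2).mul (hid.add_const 1)
      exact this.congr_deriv (by norm_num)
  have hsqrt : HasDerivAt Real.sqrt (1 / (2 * s)) D := Real.hasDerivAt_sqrt (by linarith)
  refine ⟨_, (hg.comp D hsqrt).congr_of_eventuallyEq ?_, ?_⟩
  · filter_upwards [lt_mem_nhds (show (0 : ℝ) < D by linarith)] with t ht
    rw [Function.comp_apply, ← robustnessBound_sq (Real.sqrt_pos.mpr ht), Real.sq_sqrt ht.le]
  · rw [hDs, etaThreshold_sq_lt_iff hs0] at h
    refine mul_pos (div_pos ?_ (by positivity)) (by positivity)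
    set A := s ^ 3 * η - (s ^ 2 + s + 1) * (1 - η) with hA
    -- Since s A′ = 3A + (s² + 2s + 3)(1 − η), the numerator of the derivative in s is s times the
    -- sum of this term and the next.
    have hfirst : 0 < A * (s ^ 2 + 2 * s - 1) := mul_pos h (by nlinarith)
    have hsecond : 0 ≤ (s - 1) * (s + 1) * (s ^ 2 + 2 * s + 3) * (1 - η) :=
      mul_nonneg (mul_nonneg (mul_nonneg (by linarith) (by linarith)) (by positivity))
        (by linarith)
    refine lt_of_lt_of_eq (mul_pos hs0 (add_pos_of_pos_of_nonneg hfirst hsecond)) ?_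
    rw [hA]
    ring

theorem robustnessBound_lt {D₁ D₂ η : ℝ} (h1 : 1 < D₁) (h12 : D₁ < D₂) (hη1 : η ≤ 1)
    (h : etaThreshold D₁ < η) : robustnessBound D₁ η < robustnessBound D₂ η := by
  have hd : ∀ t ∈ Set.Ici D₁, ∃ D' : ℝ, HasDerivAt (fun t => robustnessBound t η) D' t ∧ 0 < D' :=
    fun t ht => hasDerivAt_robustnessBound (h1.trans_le ht) hη1
      (etaThreshold_lt_of_le (by linarith) ht hη1 h)
  have hmono : StrictMonoOn (fun t => robustnessBound t η) (Set.Ici D₁) := by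
    refine strictMonoOn_of_deriv_pos (convex_Ici D₁) (fun t ht => ?_) fun t ht => ?_
    · obtain ⟨D', hD', -⟩ := hd t ht
      exact hD'.continuousAt.continuousWithinAt
    · obtain ⟨D', hD', hpos⟩ := hd t (interior_subset ht)
      rwa [hD'.deriv]
  exact hmono Set.self_mem_Ici h12.le h12

theorem isTheta_add_one_div_sqrt_add_one :
    (fun k : ℕ => ((k : ℝ) + 1) / (√k + 1)) =Θ[atTop] fun k : ℕ => √k := by
  have key : ∀ᶠ k : ℕ in atTop, 1 ≤ √(k : ℝ) := by
    filter_upwards [eventually_ge_atTop 1] with k hk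
    exact Real.one_le_sqrt.mpr (by exact_mod_cast hk)
  constructor
  · refine IsBigO.of_bound 1 ?_
    filter_upwards [key] with k hk
    have hsq := Real.sq_sqrt (Nat.cast_nonneg k : (0 : ℝ) ≤ k)
    rw [Real.norm_of_nonneg (by positivity), Real.norm_of_nonneg (by positivity),
      div_le_iff₀ (by positivity)]
    nlinarith
  · refine IsBigO.of_bound 2 ?_
    filter_upwards [key] with k hk
    have hsq := Real.sq_sqrt (Nat.cast_nonneg k : (0 : ℝ) ≤ k)
    rw [Real.norm_of_nonneg (by positivity), Real.norm_of_nonneg (by positivity),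
      ← mul_div_assoc, le_div_iff₀ (by positivity)]
    nlinarith [sq_nonneg (√(k : ℝ) - 1)]

end Bounds

/-! ### Upper and lower bounds on the cooling advantage. -/

section Advantage

variable {n d : ℕ} {φ : Fin n → Fin d → EuclideanSpace ℂ (Fin d)}

theorem heat_of_trace_eq {o : ℕ} {ρ : OpFamily n o d} {p : ℝ}
    (hρ : ∀ x a, (ρ x a).trace = (p : ℂ)) (β : ℝ) (H : OpFamily n o d) :
    heat β ρ H = (1 / (n : ℝ)) * ∑ x, ∑ a, ((H x a * ρ x a).trace.re -
      p * (H x a * gibbs β (H x a)).trace.re) := by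
  simp only [heat, hρ, Complex.ofReal_re]

theorem trace_mul_isotropicAssemblage_re (φ : Fin n → Fin d → EuclideanSpace ℂ (Fin d)) (η : ℝ)
    (x : Fin n) (a : Fin d) (A : Matrix (Fin d) (Fin d) ℂ) :
    (A * isotropicAssemblage φ η x a).trace.re =
      η / d * (A * ketbra (φ x a)).trace.re + (1 - η) / d ^ 2 * A.trace.re := by
  rw [isotropicAssemblage, Matrix.mul_add, Matrix.mul_smul, Matrix.mul_smul, Matrix.mul_one,
    trace_add, trace_smul, trace_smul, smul_eq_mul, smul_eq_mul, Complex.add_re,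
    Complex.re_ofReal_mul, Complex.re_ofReal_mul]

/-- The assemblage is affine in its visibility and the thermal term is common to all visibilities.
With t = 1/n this compares the steerable assemblage with an unsteerable one. -/
theorem IsMUB.heat_isotropicAssemblage_mul (hφ : IsMUB φ) (hd : 0 < d) (β t η : ℝ)
    (H : OpFamily n d d) : heat β (isotropicAssemblage φ (t * η)) H =
      t * heat β (isotropicAssemblage φ η) H +
        (1 - t) * heat β (isotropicAssemblage φ 0) H := by
  simp only [heat_of_trace_eq (hφ.trace_isotropicAssemblage hd _),
    trace_mul_isotropicAssemblage_re]
  rw [mul_left_comm t, mul_left_comm (1 - t), ← mul_add]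
  congr 1
  simp only [Finset.mul_sum, ← Finset.sum_add_distrib]
  refine Finset.sum_congr rfl fun x _ => Finset.sum_congr rfl fun a _ => ?_
  ring

/-- White noise has the average of the eigenvalues as its energy, and the thermal energy never
exceeds it. -/
theorem IsMUB.heat_isotropicAssemblage_zero_nonneg (hφ : IsMUB φ) (hd : 0 < d) {β : ℝ}
    (hβ : 0 ≤ β) {H : OpFamily n d d} (hH : ∀ x a, (H x a).IsHermitian) :
    0 ≤ heat β (isotropicAssemblage φ 0) H := by
  rw [heat_of_trace_eq (hφ.trace_isotropicAssemblage hd 0)]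
  refine mul_nonneg (by positivity) (Finset.sum_nonneg fun x _ => Finset.sum_nonneg fun a _ => ?_)
  rw [trace_mul_isotropicAssemblage_re, sub_nonneg]
  have h := mul_le_mul_of_nonneg_left (trace_mul_gibbs_le (hH x a) hd hβ)
    (show (0 : ℝ) ≤ 1 / d by positivity)
  refine h.trans_eq ?_
  field_simp
  ring

theorem IsMUB.mem_unsteerableWith (hφ : IsMUB φ) (hn : 0 < n) (hd : 0 < d) {ζ : ℝ} (η : ℝ)
    (hζ0 : 0 ≤ ζ) (hζ1 : ζ ≤ 1) :
    isotropicAssemblage φ (ζ / n) ∈ unsteerableWith (isotropicAssemblage φ η) :=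
  ⟨hφ.isUnsteerable_isotropicAssemblage hn hd hζ0 hζ1, fun x a => by
    rw [hφ.trace_isotropicAssemblage hd, hφ.trace_isotropicAssemblage hd]⟩

/-- The advantage of an isotropic assemblage is at most the number of settings. -/
theorem IsMUB.xiMax_le (hφ : IsMUB φ) (hn : 0 < n) (hd : 0 < d) {β : ℝ} (hβ : 0 ≤ β) {η : ℝ}
    (hη0 : 0 ≤ η) (hη1 : η ≤ 1) :
    xiMax β (isotropicAssemblage φ η) ≤ ((n : ℝ) : EReal) := by
  refine iSup₂_le fun H hH => ?_
  obtain ⟨hHerm, hpos⟩ := hH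
  have hn' : (1 : ℝ) ≤ n := by exact_mod_cast hn
  -- The real supremum of an unbounded set is 0, so a positive denominator forces boundedness.
  have hbdd : BddAbove ((fun σ => heat β σ H) '' unsteerableWith (isotropicAssemblage φ η)) := by
    by_contra h
    rw [classicalHeat, Real.sSup_of_not_bddAbove h] at hpos
    exact lt_irrefl _ hpos
  have hle : heat β (isotropicAssemblage φ (η / n)) H ≤
      classicalHeat β (isotropicAssemblage φ η) H :=
    le_csSup hbdd ⟨_, hφ.mem_unsteerableWith hn hd η hη0 hη1, rfl⟩
  have haff := hφ.heat_isotropicAssemblage_mul hd β (1 / n) η H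
  rw [one_div_mul_eq_div] at haff
  have h0 := hφ.heat_isotropicAssemblage_zero_nonneg hd hβ hHerm
  have h1 : 0 ≤ (1 - 1 / (n : ℝ)) * heat β (isotropicAssemblage φ 0) H :=
    mul_nonneg (sub_nonneg.mpr ((div_le_one (by linarith)).mpr hn')) h0
  rw [EReal.coe_le_coe_iff, div_le_iff₀ hpos]
  have h2 : 1 / (n : ℝ) * heat β (isotropicAssemblage φ η) H ≤
      classicalHeat β (isotropicAssemblage φ η) H := by linarith
  rwa [one_div, inv_mul_le_iff₀ (by linarith)] at h2

/-- The heat withdrawn with scaled basis projections as Hamiltonians. -/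
theorem IsMUB.heat_smul_ketbra (hφ : IsMUB φ) (hd : 0 < d) {σ : OpFamily n d d}
    (hσ : ∀ x a, (σ x a).trace = ((1 / d : ℝ) : ℂ)) (β E : ℝ) :
    heat β σ (fun x a => (E : ℂ) • ketbra (φ x a)) =
      E / n * (∑ x, ∑ a, (ketbra (φ x a) * σ x a).trace.re -
        n * (Real.exp (-(β * E)) / (d - 1 + Real.exp (-(β * E))))) := by
  have hd' : (d : ℝ) ≠ 0 := by exact_mod_cast hd.ne'
  rw [heat_of_trace_eq hσ]
  simp only [trace_smul_ketbra_mul_gibbs (hφ.norm_eq_one _ _)]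
  simp only [Matrix.smul_mul, trace_smul,
    smul_eq_mul, Complex.re_ofReal_mul, Finset.sum_sub_distrib, ← Finset.mul_sum,
    Finset.sum_const, Finset.card_univ, Fintype.card_fin, nsmul_eq_mul]
  field_simp

/-- With the Hamiltonians E |φ⟩⟨φ| the witness bounds the classical heat by (E/N)(c − N g), where g
is the thermal population of the level E; the quantum heat is (E/N)(c · `xiBound` − N g), and g → 0
as E → ∞. -/
theorem IsMUB.xiBound_le_xiMax {φ : Fin (d + 1) → Fin d → EuclideanSpace ℂ (Fin d)}
    (hφ : IsMUB φ) (hd : 1 < d) {β : ℝ} (hβ : 0 < β) {η : ℝ} (hη0 : 0 ≤ η) :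
    ((xiBound d η : ℝ) : EReal) ≤ xiMax β (isotropicAssemblage φ η) := by
  have hd0 : 0 < d := by omega
  have hd1 : (1 : ℝ) < d := by exact_mod_cast hd
  have hdr : (0 : ℝ) < d := by linarith
  set c := 1 + √(d : ℝ) with hc
  have hc0 : 0 < c := by positivity
  set N : ℝ := ((d + 1 : ℕ) : ℝ) with hN
  have hN0 : 0 < N := by positivity
  have hNd : N = d + 1 := by rw [hN]; push_cast; rfl
  have hval : ∀ ζ : ℝ, ∑ x, ∑ a, (ketbra (φ x a) * isotropicAssemblage φ ζ x a).trace.re =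
      N * (ζ + (1 - ζ) / d) := by
    intro ζ
    simp only [hφ.trace_ketbra_mul_isotropicAssemblage, Complex.ofReal_re, Finset.sum_const,
      Finset.card_univ, Fintype.card_fin, nsmul_eq_mul, ← hN]
    field_simp
  have hV : N * (η + (1 - η) / d) = c * xiBound d η := by
    rw [xiBound, ← hc, hNd]
    field_simp
    ring
  have hVge : N * (1 / d) ≤ N * (η + (1 - η) / d) := by
    refine mul_le_mul_of_nonneg_left ?_ hN0.le
    have : η + (1 - η) / d - 1 / d = η * (1 - 1 / d) := by ring
    have h2 : 0 ≤ η * (1 - 1 / (d : ℝ)) :=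
      mul_nonneg hη0 (sub_nonneg.mpr ((div_le_one hdr).mpr hd1.le))
    linarith
  have hclass : ∀ σ : OpFamily (d + 1) d d, IsUnsteerable σ →
      ∑ x, ∑ a, (ketbra (φ x a) * σ x a).trace.re ≤ c := by
    intro σ hσ
    have h := hφ.isDualFeasible_mubWitness.sum_trace_le_one hσ
    simp only [mubWitness, Matrix.smul_mul, trace_smul, smul_eq_mul, Complex.re_ofReal_mul,
      ← Finset.mul_sum, ← hc] at h
    rwa [one_div, inv_mul_le_iff₀ hc0, mul_one] at h
  have hE : ∀ E : ℝ, 0 < E →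
      (((c * xiBound d η - N * Real.exp (-(β * E))) / c : ℝ) : EReal) ≤
        xiMax β (isotropicAssemblage φ η) := by
    intro E hE
    set e := Real.exp (-(β * E)) with he
    have he0 : 0 < e := Real.exp_pos _
    have he1 : e < 1 := Real.exp_lt_one_iff.mpr (neg_neg_of_pos (mul_pos hβ hE))
    set g := e / (d - 1 + e) with hg
    have hg0 : 0 < g := div_pos he0 (by linarith)
    have hge : g ≤ e := by
      have hd2 : (2 : ℝ) ≤ d := by exact_mod_cast hd
      exact div_le_self he0.le (by linarith)
    have hgd : g < 1 / d := by
      rw [hg, div_lt_div_iff₀ (by linarith) hdr]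
      nlinarith
    set H : OpFamily (d + 1) d d := fun x a => (E : ℂ) • ketbra (φ x a) with hH
    have hHerm : ∀ x a, (H x a).IsHermitian := fun x a =>
      (posSemidef_ofReal_smul (ketbra_posSemidef _) hE.le).isHermitian
    have hheat : ∀ σ : OpFamily (d + 1) d d, (∀ x a, (σ x a).trace = ((1 / d : ℝ) : ℂ)) →
        heat β σ H = E / N * (∑ x, ∑ a, (ketbra (φ x a) * σ x a).trace.re - N * g) :=
      fun σ hσ => hφ.heat_smul_ketbra hd0 hσ β E
    have hub : ∀ q ∈ (fun σ => heat β σ H) '' unsteerableWith (isotropicAssemblage φ η),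
        q ≤ E / N * (c - N * g) := by
      rintro _ ⟨σ, ⟨hσ, htr⟩, rfl⟩
      simp only [hφ.trace_isotropicAssemblage hd0] at htr
      refine (hheat σ htr).trans_le ?_
      exact mul_le_mul_of_nonneg_left (sub_le_sub_right (hclass σ hσ) _) (by positivity)
    have hmem := hφ.mem_unsteerableWith d.succ_pos hd0 η le_rfl zero_le_one
    rw [zero_div] at hmem
    have hle : classicalHeat β (isotropicAssemblage φ η) H ≤ E / N * (c - N * g) :=
      csSup_le ⟨_, _, hmem, rfl⟩ hub
    -- As g < 1/d for E > 0, white noise already withdraws positive heat. This makes the denominator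
    -- positive and, with `hVge`, the numerator nonnegative.
    have hlt : N * g < N * (1 / d) := mul_lt_mul_of_pos_left hgd hN0
    have hpos : 0 < classicalHeat β (isotropicAssemblage φ η) H := by
      refine lt_of_lt_of_le ?_ (le_csSup ⟨_, hub⟩ ⟨_, hmem, rfl⟩)
      refine lt_of_lt_of_eq ?_ (hheat _ (hφ.trace_isotropicAssemblage hd0 0)).symm
      rw [hval]
      refine mul_pos (by positivity) ?_
      rw [zero_add, sub_zero]
      linarith
    -- Dropping −N g enlarges the denominator, which only lowers the ratio because its numerator is
    -- nonnegative.
    have hle' : classicalHeat β (isotropicAssemblage φ η) H ≤ E / N * c :=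
      hle.trans (mul_le_mul_of_nonneg_left (by nlinarith) (by positivity))
    refine le_trans ?_ (le_iSup₂_of_le H ⟨hHerm, hpos⟩ le_rfl)
    rw [EReal.coe_le_coe_iff, hheat _ (hφ.trace_isotropicAssemblage hd0 η), hval]
    calc (c * xiBound d η - N * e) / c ≤ (N * (η + (1 - η) / d) - N * g) / c := by
          rw [hV]
          have := mul_le_mul_of_nonneg_left hge hN0.le
          gcongr
      _ = E / N * (N * (η + (1 - η) / d) - N * g) / (E / N * c) := by
          rw [mul_div_mul_left _ _ (by positivity)]
      _ ≤ _ := div_le_div_of_nonneg_left (mul_nonneg (by positivity) (by linarith)) hpos hle'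
  have hlim : Tendsto (fun E : ℝ => (c * xiBound d η - N * Real.exp (-(β * E))) / c) atTop
      (nhds (xiBound d η)) := by
    have h1 : Tendsto (fun E : ℝ => Real.exp (-(β * E))) atTop (nhds 0) :=
      Real.tendsto_exp_neg_atTop_nhds_zero.comp (tendsto_id.const_mul_atTop hβ)
    have h2 := ((h1.const_mul N).const_sub (c * xiBound d η)).div_const c
    rwa [mul_zero, sub_zero, mul_div_cancel_left₀ _ hc0.ne'] at h2
  exact le_of_tendsto ((continuous_coe_real_ereal.tendsto _).comp hlim)
    ((eventually_gt_atTop 0).mono hE)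

end Advantage

end Cooling

end

/-! ### Assembly of the results. -/

theorem mainTheorem2 {d : ℕ} (hd : IsPrimePow d)
    (φ : Fin (d + 1) → Fin d → EuclideanSpace ℂ (Fin d)) (hφ : Cooling.IsMUB φ)
    (β : ℝ) (hβ : 0 < β) (η : ℝ) (hη0 : 0 ≤ η) (hη1 : η ≤ 1) :
    -- the family is an assemblage, and the chosen operators are dual-feasible with this value
    Cooling.IsAssemblage (Cooling.isotropicAssemblage φ η) ∧
    Cooling.IsDualFeasible (Cooling.mubWitness φ) ∧
    (∑ x, ∑ a, (Cooling.mubWitness φ x a * Cooling.isotropicAssemblage φ η x a).trace =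
      ((1 + Cooling.robustnessBound d η : ℝ) : ℂ)) ∧
    -- the bounds on the robustness and on the (finite) advantage
    Cooling.robustnessBound d η ≤
      Cooling.steeringRobustness (Cooling.isotropicAssemblage φ η) ∧
    ((Cooling.xiBound d η : ℝ) : EReal) ≤ Cooling.xiMax β (Cooling.isotropicAssemblage φ η) ∧
    Cooling.xiMax β (Cooling.isotropicAssemblage φ η) ≠ ⊤ ∧
    -- the maximally entangled case
    Cooling.isotropicAssemblage φ 1 = Cooling.maxEntAssemblage φ ∧
    Real.sqrt d * ((Real.sqrt d - 1) / (Real.sqrt d + 1)) ≤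
      Cooling.steeringRobustness (Cooling.maxEntAssemblage φ) ∧
    ((((d : ℝ) + 1) / (Real.sqrt d + 1) : ℝ) : EReal) ≤
      Cooling.xiMax β (Cooling.maxEntAssemblage φ) ∧
    ((fun k : ℕ => ((k : ℝ) + 1) / (Real.sqrt k + 1)) =Θ[atTop] fun k : ℕ => Real.sqrt k) ∧
    -- positivity of the advantage
    (0 < Cooling.robustnessBound d η ↔ Cooling.etaThreshold d < η) ∧
    (Cooling.etaThreshold d < η →
      0 < Cooling.steeringRobustness (Cooling.isotropicAssemblage φ η) ∧
      1 < Cooling.xiMax β (Cooling.isotropicAssemblage φ η)) ∧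
    -- growth of the lower bounds with the dimension
    (∀ D : ℝ, 1 < D → Cooling.xiBound D η = 1 + Cooling.robustnessBound D η) ∧
    (∀ D : ℝ, 1 < D → Cooling.etaThreshold D < η →
      ∃ D' : ℝ, HasDerivAt (fun t => Cooling.robustnessBound t η) D' D ∧ 0 < D') ∧
    (∀ D₁ D₂ : ℝ, 1 < D₁ → D₁ < D₂ → Cooling.etaThreshold D₁ < η →
      Cooling.robustnessBound D₁ η < Cooling.robustnessBound D₂ η ∧
      Cooling.xiBound D₁ η < Cooling.xiBound D₂ η) := by
  have hd1 : 1 < d := hd.one_lt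
  have hdr : (1 : ℝ) < d := by exact_mod_cast hd1
  have hd0 : 0 < d := by omega
  have hxi : ∀ D : ℝ, 1 < D → ∀ ζ, Cooling.xiBound D ζ = 1 + Cooling.robustnessBound D ζ :=
    fun D hD ζ => Cooling.xiBound_eq (by linarith) ζ
  have hrob : ∀ ζ : ℝ, 0 ≤ ζ → ζ ≤ 1 → Cooling.robustnessBound d ζ ≤
      Cooling.steeringRobustness (Cooling.isotropicAssemblage φ ζ) := fun ζ h0 h1 => by
    have h := hφ.xiBound_sub_one_le_steeringRobustness hd1 h0 h1
    rwa [hxi d hdr, add_sub_cancel_left] at h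
  have hpos := Cooling.robustnessBound_pos_iff hdr η
  refine ⟨hφ.isAssemblage_isotropicAssemblage hd0 hη0 hη1, hφ.isDualFeasible_mubWitness, ?_,
    hrob η hη0 hη1, hφ.xiBound_le_xiMax hd1 hβ hη0, ?_, Cooling.isotropicAssemblage_one φ, ?_, ?_,
    Cooling.isTheta_add_one_div_sqrt_add_one, hpos, fun h => ⟨?_, ?_⟩, fun D hD => hxi D hD η,
    fun D hD h => Cooling.hasDerivAt_robustnessBound hD hη1 h, fun D₁ D₂ h1 h12 h => ?_⟩
  · rw [hφ.sum_trace_mubWitness_mul hd0, hxi d hdr]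
  · exact ((hφ.xiMax_le d.succ_pos hd0 hβ.le hη0 hη1).trans_lt (EReal.coe_lt_top _)).ne
  · have h := hrob 1 zero_le_one le_rfl
    rw [Cooling.isotropicAssemblage_one] at h
    refine le_of_eq_of_le ?_ h
    simp [Cooling.robustnessBound]
  · have h := hφ.xiBound_le_xiMax hd1 hβ zero_le_one
    rw [Cooling.isotropicAssemblage_one] at h
    refine le_of_eq_of_le ?_ h
    rw [EReal.coe_eq_coe_iff, Cooling.xiBound]
    have : (d : ℝ) ≠ 0 := by positivity
    field_simp
    ring
  · exact (hpos.mpr h).trans_le (hrob η hη0 hη1)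
  · refine lt_of_lt_of_le ?_ (hφ.xiBound_le_xiMax hd1 hβ hη0)
    rw [← EReal.coe_one, EReal.coe_lt_coe_iff, hxi d hdr]
    linarith [hpos.mpr h]
  · have hlt := Cooling.robustnessBound_lt h1 h12 hη1 h
    refine ⟨hlt, ?_⟩
    rw [hxi D₁ h1, hxi D₂ (h1.trans h12)]
    linarith
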